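/- Let $f:\mathbb R^{d}\to\mathbb R$ be a $C^\infty$ function and let $D\subset\mathbb R^d$ be a $C^\infty$ open, bounded and connected (nonempty) set; that is, every boundary point of $D$ has an open neighbourhood $U$ carrying a $C^\infty$ function $\rho$ with nowhere vanishing differential such that $D\cap U=\{y\in U:\rho(y)<0\}$. Critical points of $f|_{\partial D}$ and their nondegeneracy are those of the restriction of $f$ to the smooth hypersurface $\partial D$: $x\in\partial D$ is critical if $d_xf$ vanishes on $T_x\partial D$, and it is nondegenerate if the Hessian of $f|_{\partial D}$ at $x$, read in a local parametrization of $\partial D$, is invertible. For $A\subset\partial D$, $f|_{\partial D}$ is Morse on $A$ if all its critical points in $A$ are nondegenerate. Assume that $$\forall x\in\partial D,\quad \mathbb R\,\nabla f(x)\oplus T_x\partial D=\mathbb R^d .$$ Let $S_1$ be a (relatively) open subset of $\partial D$ such that $f:\overline{S_1}\to\mathbb R$ is a Morse function (that is, $f|_{\partial D}$ is Morse on $\overline{S_1}$) and $f|_{\partial D}$ has no critical point on the boundary $\overline{S_1}\setminus S_1$ of $S_1$ in $\partial D$. Let $S_1'$ be a (relatively) open subset of $\partial D$ such that $\overline{S_1'}\subset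 S_1$ and such that $f|_{\partial D}$ has no critical point on $\overline{S_1\setminus S_1'}$. Then, for all open sets $\mathcal V_-,\mathcal V_+\subset\mathbb R^d$ such that $\overline{\mathcal V_-}\subset D\cup S_1'$ and $\overline D\setminus S_1'\subset\mathcal V_+$, there exists a $C^\infty$ open, bounded and connected set $D'\subset\mathbb R^d$ such that $S_1'\subset\partial D'$, $$\overline{\mathcal V_-}\subset D'\cup S_1',\qquad \overline{D'}\setminus S_1'\subset\mathcal V_+,$$ and $f|_{\partial D'}$ is a Morse function, i.e. all critical points of $f|_{\partial D'}$ are nondegenerate. -/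

import Mathlib

open scoped ContDiff

namespace MorseDomain

/-- The Euclidean space `ℝ^d`. -/
abbrev E (d : ℕ) : Type := EuclideanSpace ℝ (Fin d)

/-- `ρ` is a smooth defining function of the set `D` on the open set `U`: it is smooth on `U`,
its differential vanishes nowhere on `U`, and `D` is the set `{ρ < 0}` inside `U`. -/
structure IsDefiningFunctionOn {d : ℕ} (D U : Set (E d)) (ρ : E d → ℝ) : Prop where
  contDiffOn : ContDiffOn ℝ ∞ ρ U
  fderiv_ne_zero : ∀ y ∈ U, fderiv ℝ ρ y ≠ 0
  inter_eq : D ∩ U = {y ∈ U | ρ y < 0}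

/-- A `C^∞` open bounded and connected (in particular nonempty) subset of `ℝ^d`: every boundary
point has a neighbourhood on which the set has a smooth defining function. -/
structure IsSmoothBoundedDomain {d : ℕ} (D : Set (E d)) : Prop where
  isOpen : IsOpen D
  isBounded : Bornology.IsBounded D
  isConnected : IsConnected D
  smooth_frontier : ∀ x ∈ frontier D, ∃ (U : Set (E d)) (ρ : E d → ℝ),
    IsOpen U ∧ x ∈ U ∧ IsDefiningFunctionOn D U ρ

/-- The velocities at `x` of smooth curves contained in `S`. -/
def velocities {d : ℕ} (S : Set (E d)) (x : E d) : Set (E d) :=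
  {v | ∃ (ε : ℝ) (γ : ℝ → E d), 0 < ε ∧ ContDiffOn ℝ ∞ γ (Set.Ioo (-ε) ε) ∧
    (∀ t ∈ Set.Ioo (-ε) ε, γ t ∈ S) ∧ γ 0 = x ∧ deriv γ 0 = v}

/-- The tangent space `T_x S`, as a linear subspace of `ℝ^d`. When `S` is a smooth hypersurface
through `x`, the set of velocities is itself a linear subspace and the span adds nothing. -/
def tangentSpace {d : ℕ} (S : Set (E d)) (x : E d) : Submodule ℝ (E d) :=
  Submodule.span ℝ (velocities S x)

/-- `φ : W → S` is a smooth local parametrization (the inverse of a chart), centred at `x`, of the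
`n`-dimensional submanifold `S` of `ℝ^d`: an immersion of the open set `W ∋ 0` which is a
homeomorphism onto a relatively open subset of `S`, with `φ 0 = x`. -/
structure IsLocalParam {n d : ℕ} (S : Set (E d)) (x : E d) (W : Set (E n)) (φ : E n → E d) :
    Prop where
  isOpen : IsOpen W
  zero_mem : (0 : E n) ∈ W
  map_zero : φ 0 = x
  contDiffOn : ContDiffOn ℝ ∞ φ W
  injective_fderiv : ∀ y ∈ W, Function.Injective (fderiv ℝ φ y)
  isEmbedding : Topology.IsEmbedding (W.domRestrict φ)
  image_eq : ∃ U : Set (E d), IsOpen U ∧ φ '' W = S ∩ U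

/-- `x` is a critical point of `f|_S`: `x ∈ S` and `d_x f` vanishes on `T_x S`. -/
def IsCriticalPoint {d : ℕ} (f : E d → ℝ) (S : Set (E d)) (x : E d) : Prop :=
  x ∈ S ∧ ∀ v ∈ tangentSpace S x, fderiv ℝ f x v = 0

/-- The Hessian of `f|_S` at (the critical point) `x` is nondegenerate, where `S` is a
hypersurface of `ℝ^d`: read in a local parametrization of `S` centred at `x`, the second derivative
is a nondegenerate bilinear form. At a critical point this does not depend on the parametrization.
(If `S` is nonempty and is the boundary of an open set, then `d ≥ 1`, so that `d - 1` is the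
dimension of `S`.) -/
def HasNondegenerateHessian {d : ℕ} (f : E d → ℝ) (S : Set (E d)) (x : E d) : Prop :=
  ∃ (W : Set (E (d - 1))) (φ : E (d - 1) → E d), IsLocalParam S x W φ ∧
    ∀ u : E (d - 1), (∀ w : E (d - 1), fderiv ℝ (fderiv ℝ (f ∘ φ)) 0 u w = 0) → u = 0

/-- All the critical points of `f|_S` that lie in `A ⊆ S` are nondegenerate. -/
def IsMorseOn {d : ℕ} (f : E d → ℝ) (S A : Set (E d)) : Prop :=
  ∀ x ∈ A, IsCriticalPoint f S x → HasNondegenerateHessian f S x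

/-- `A` is a relatively open subset of `S`. -/
def IsRelOpen {d : ℕ} (S A : Set (E d)) : Prop :=
  ∃ U : Set (E d), IsOpen U ∧ A = S ∩ U

end MorseDomain

open MorseDomain

namespace MorseDomain

open Set Filter Topology

/-! Glue the local defining functions into one smooth `ρ`, with `D = {ρ < 0}` near `∂D`.
Transversality forces `df ≠ 0` on `∂D`, hence on a neighbourhood `W`. Take a cutoff `χ` equal to 1
near `∂D \ S₁`, supported in `W ∩ Vp` away from `closure S₁'`, and replace `ρ` by `ρ + χ (q + c)`,
with `q` linear and `c` constant.

Critical points on the new boundary fall into three zones. Where `χ = 1` near the point,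
`dense_nondegenerate_affine` (Sard with the Lagrange multiplier as an extra unknown) and
`hasNondegenerateHessian_of_lagrange` give nondegeneracy for generic `(q, c)`. In the rest of the
support the old boundary lies in `S₁ \ S₁'` and has no critical point, which survives small
perturbations by compactness. Off the support the boundary is unchanged and lies in `S₁`, where `f`
is already Morse.

Choosing `(q, c)` near `(0, -ε)` makes `q + c` negative on the support, so the domain only grows;
`eventually_exists_isPreconnected` joins the gained points to `D`. -/

/-! ### Defining functions and the boundary. -/

/-- A function vanishing at `x` is positive just after `x` along a direction of increase. -/
theorem eventually_pos_of_fderiv_pos {F : Type*} [NormedAddCommGroup F] [NormedSpace ℝ F]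
    {g : F → ℝ} {x v : F} (hg : DifferentiableAt ℝ g x) (hx : g x = 0)
    (hv : 0 < fderiv ℝ g x v) : ∀ᶠ t in 𝓝[>] (0 : ℝ), 0 < g (x + t • v) := by
  have h1 : HasDerivAt (fun t : ℝ => g (x + t • v)) (fderiv ℝ g x v) 0 := by
    have h2 : HasDerivAt (fun t : ℝ => x + t • v) v 0 := by
      simpa using ((hasDerivAt_id (0 : ℝ)).smul_const v).const_add x
    have h3 : HasFDerivAt g (fderiv ℝ g x) (x + (0 : ℝ) • v) := by
      simpa using hg.hasFDerivAt
    exact h3.comp_hasDerivAt 0 h2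
  have h4 := (hasDerivAt_iff_tendsto_slope.1 h1).eventually (lt_mem_nhds hv)
  have h5 : ∀ᶠ t in 𝓝[>] (0 : ℝ), 0 < slope (fun t : ℝ => g (x + t • v)) 0 t :=
    h4.filter_mono (nhdsWithin_mono _ fun t ht => ne_of_gt ht)
  filter_upwards [h5, self_mem_nhdsWithin] with t ht ht0
  have ht0 : 0 < t := ht0
  rw [slope_def_field] at ht
  simp only [zero_smul, add_zero, hx, sub_zero] at ht
  exact (div_pos_iff_of_pos_right ht0).1 ht

theorem tendsto_add_smul {F : Type*} [NormedAddCommGroup F] [NormedSpace ℝ F] (x v : F) :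
    Tendsto (fun t : ℝ => x + t • v) (𝓝[>] 0) (𝓝 x) := by
  have : Continuous fun t : ℝ => x + t • v := by fun_prop
  have h := this.tendsto 0
  simp only [zero_smul, add_zero] at h
  exact h.mono_left nhdsWithin_le_nhds

namespace IsDefiningFunctionOn

variable {d : ℕ} {D U : Set (E d)} {ρ : E d → ℝ} {x : E d}

theorem neg_iff (h : IsDefiningFunctionOn D U ρ) (hx : x ∈ U) : ρ x < 0 ↔ x ∈ D := by
  have := Set.ext_iff.1 h.inter_eq x
  simp only [mem_inter_iff, hx, and_true, mem_ofPred_eq, true_and] at this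
  exact this.symm

theorem contDiffAt (h : IsDefiningFunctionOn D U ρ) (hU : IsOpen U) (hx : x ∈ U) :
    ContDiffAt ℝ ∞ ρ x :=
  h.contDiffOn.contDiffAt (hU.mem_nhds hx)

theorem differentiableAt (h : IsDefiningFunctionOn D U ρ) (hU : IsOpen U) (hx : x ∈ U) :
    DifferentiableAt ℝ ρ x :=
  (h.contDiffAt hU hx).differentiableAt (by simp)

/-- A defining function vanishes exactly on the boundary. -/
theorem mem_frontier_iff (h : IsDefiningFunctionOn D U ρ) (hD : IsOpen D) (hU : IsOpen U)
    (hx : x ∈ U) : x ∈ frontier D ↔ ρ x = 0 := by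
  constructor
  · intro hxD
    rw [hD.frontier_eq] at hxD
    have h1 : 0 ≤ ρ x := by
      by_contra hlt
      exact hxD.2 ((h.neg_iff hx).1 (not_le.1 hlt))
    refine le_antisymm ?_ h1
    by_contra hlt
    have h2 : ∀ᶠ y in 𝓝 x, 0 < ρ y ∧ y ∈ U :=
      ((h.differentiableAt hU hx).continuousAt.eventually (lt_mem_nhds (not_le.1 hlt))).and
        (hU.mem_nhds hx)
    obtain ⟨y, hyD, hy, hyU⟩ := ((mem_closure_iff_frequently.1 hxD.1).and_eventually h2).exists
    exact absurd ((h.neg_iff hyU).2 hyD) hy.not_gt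
  · intro h0
    have hxD : x ∉ D := fun hxD => (h0 ▸ (h.neg_iff hx).2 hxD).false
    rw [hD.frontier_eq]
    refine ⟨?_, hxD⟩
    obtain ⟨v, hv⟩ : ∃ v, fderiv ℝ ρ x v ≠ 0 := by
      by_contra! hall
      exact h.fderiv_ne_zero x hx (ContinuousLinearMap.ext hall)
    -- Along a descent direction `w`, the points `x + t • w` with small `t > 0` lie in `D` and tend
    -- to `x`.
    obtain ⟨w, hw⟩ : ∃ w, 0 < fderiv ℝ (fun y => -ρ y) x w := by
      rw [fderiv_fun_neg]
      rcases lt_or_gt_of_ne hv with hv | hv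
      · exact ⟨v, by simpa using hv⟩
      · exact ⟨-v, by simpa using hv⟩
    have h1 := eventually_pos_of_fderiv_pos (h.differentiableAt hU hx).neg (by simp [h0]) hw
    have h2 := (tendsto_add_smul x w).eventually (hU.mem_nhds hx)
    refine mem_closure_of_tendsto (tendsto_add_smul x w) ?_
    filter_upwards [h1, h2] with t ht htU
    exact (h.neg_iff htU).1 (by simpa using ht)

/-- Two defining functions at a boundary point have positively proportional differentials; only
the compatibility of signs is recorded. -/
theorem fderiv_nonneg (h : IsDefiningFunctionOn D U ρ) (hD : IsOpen D) (hU : IsOpen U)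
    {U' : Set (E d)} {ρ' : E d → ℝ} (h' : IsDefiningFunctionOn D U' ρ') (hU' : IsOpen U')
    (hx : x ∈ U) (hx' : x ∈ U') (hxD : x ∈ frontier D) {v : E d} (hv : 0 < fderiv ℝ ρ x v) :
    0 ≤ fderiv ℝ ρ' x v := by
  by_contra! hneg
  have h1 := eventually_pos_of_fderiv_pos (h.differentiableAt hU hx)
    ((h.mem_frontier_iff hD hU hx).1 hxD) hv
  have h2 := eventually_pos_of_fderiv_pos (v := v) (h'.differentiableAt hU' hx').neg
    (by simp [(h'.mem_frontier_iff hD hU' hx').1 hxD])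
    (by rw [fderiv_neg]; simpa using hneg)
  have h3 := (tendsto_add_smul x v).eventually
    ((hU.eventually_mem hx).and (hU'.eventually_mem hx'))
  obtain ⟨t, ht1, ht2, htU, htU'⟩ := (h1.and (h2.and h3)).exists
  have ht2 : ρ' (x + t • v) < 0 := by simpa using ht2
  exact ht1.not_gt ((h.neg_iff htU).2 ((h'.neg_iff htU').1 ht2))

/-- The tangent space of the boundary is contained in the kernel of the differential. -/
theorem fderiv_eq_zero_of_mem_tangentSpace (h : IsDefiningFunctionOn D U ρ) (hD : IsOpen D)
    (hU : IsOpen U) (hx : x ∈ U) {v : E d} (hv : v ∈ tangentSpace (frontier D) x) :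
    fderiv ℝ ρ x v = 0 := by
  have hle : tangentSpace (frontier D) x ≤ LinearMap.ker (fderiv ℝ ρ x).toLinearMap := by
    refine Submodule.span_le.2 ?_
    rintro v ⟨ε, γ, hε, hγ, hγS, rfl, rfl⟩
    have h0 : Ioo (-ε) ε ∈ 𝓝 (0 : ℝ) := Ioo_mem_nhds (by simpa) hε
    have hd : HasDerivAt γ (deriv γ 0) 0 :=
      ((hγ.contDiffAt h0).differentiableAt (by simp)).hasDerivAt
    have h1 := (h.differentiableAt hU hx).hasFDerivAt.comp_hasDerivAt 0 hd
    have h2 : ρ ∘ γ =ᶠ[𝓝 0] fun _ => 0 := by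
      filter_upwards [h0, hd.continuousAt.eventually (hU.mem_nhds hx)] with t ht htU
      exact (h.mem_frontier_iff hD hU htU).1 (hγS t ht)
    exact h1.unique ((hasDerivAt_const (0 : ℝ) (0 : ℝ)).congr_of_eventuallyEq h2)
  exact hle hv

end IsDefiningFunctionOn

/-! ### Local parametrizations of level sets. -/

/-- A nonzero linear form on `ℝ^d` is the first component of a linear isomorphism onto
`ℝ × ℝ^(d-1)`. -/
theorem exists_equiv_prod_of_ne_zero {d : ℕ} {ℓ : E d →L[ℝ] ℝ} (hℓ : ℓ ≠ 0) :
    ∃ A : E d ≃L[ℝ] ℝ × E (d - 1), ∀ v, (A v).1 = ℓ v := by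
  obtain ⟨z, hz⟩ : ∃ z, ℓ z = 1 := by
    obtain ⟨v, hv⟩ : ∃ v, ℓ v ≠ 0 := by
      by_contra! hall
      exact hℓ (ContinuousLinearMap.ext hall)
    exact ⟨(ℓ v)⁻¹ • v, by simp [hv]⟩
  have hℓ' : (ℓ.toLinearMap : Module.Dual ℝ (E d)) ≠ 0 := by
    intro h0
    have := LinearMap.congr_fun h0 z
    simp [hz] at this
  -- The kernel has dimension one less than `d`; in particular `d ≥ 1`, so the truncated subtraction
  -- `d - 1` is harmless.
  have hfin : Module.finrank ℝ (LinearMap.ker ℓ.toLinearMap) = Module.finrank ℝ (E (d - 1)) := by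
    have := Module.Dual.finrank_ker_add_one_of_ne_zero hℓ'
    simp only [finrank_euclideanSpace, Fintype.card_fin] at this ⊢
    omega
  let e : LinearMap.ker ℓ.toLinearMap ≃ₗ[ℝ] E (d - 1) := LinearEquiv.ofFinrankEq _ _ hfin
  let p : E d →ₗ[ℝ] LinearMap.ker ℓ.toLinearMap :=
    (LinearMap.id - ℓ.toLinearMap.smulRight z).codRestrict _ (fun v => by simp [hz])
  have hp : ∀ v, (p v : E d) = v - ℓ v • z := fun v => rfl
  let A : E d ≃ₗ[ℝ] ℝ × E (d - 1) :=
    LinearEquiv.ofLinearMap (ℓ.toLinearMap.prod (e.toLinearMap ∘ₗ p))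
      ((LinearMap.toSpanSingleton ℝ (E d) z).coprod
        ((LinearMap.ker ℓ.toLinearMap).subtype ∘ₗ e.symm.toLinearMap))
      (by
        refine LinearMap.ext fun ⟨t, u⟩ => ?_
        have hk : ℓ (e.symm u : E d) = 0 := (e.symm u).2
        refine Prod.ext ?_ ?_
        · simp [hz, hk]
        · have : p (t • z + (e.symm u : E d)) = e.symm u := by
            refine Subtype.ext ?_
            simp [hp, hz, hk]
          simp [this])
      (by
        refine LinearMap.ext fun v => ?_
        simp [hp])
  exact ⟨A.toContinuousLinearEquiv, fun v => rfl⟩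

/-- A level set of a smooth function at a regular point has a smooth local parametrization, whose
differential maps onto the kernel of the differential of the function. -/
theorem exists_isLocalParam {d : ℕ} {S O : Set (E d)} {σ : E d → ℝ} {x : E d} (hO : IsOpen O)
    (hσ : ContDiffOn ℝ ∞ σ O) (hS : S ∩ O = {y ∈ O | σ y = 0}) (hxS : x ∈ S) (hxO : x ∈ O)
    (hx : fderiv ℝ σ x ≠ 0) :
    ∃ (W : Set (E (d - 1))) (φ : E (d - 1) → E d), IsLocalParam S x W φ ∧
      (∀ u ∈ W, σ (φ u) = 0) ∧ (∀ u, fderiv ℝ σ x (fderiv ℝ φ 0 u) = 0) ∧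
      ∀ v, fderiv ℝ σ x v = 0 → ∃ u, fderiv ℝ φ 0 u = v := by
  obtain ⟨A, hA⟩ := exists_equiv_prod_of_ne_zero hx
  have hS' : ∀ {y}, y ∈ O → (y ∈ S ↔ σ y = 0) := fun {y} hy => by
    have := Set.ext_iff.1 hS y
    simpa [hy] using this
  -- `Ψ` straightens the level set to `{0} × E (d - 1)`, and its derivative at `x` is `A`. The
  -- parametrization is its local inverse on that slice.
  set Ψ : E d → ℝ × E (d - 1) := fun y => (σ y, (A (y - x)).2) with hΨdef
  have hΨO : ContDiffOn ℝ ∞ Ψ O := by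
    refine hσ.prodMk (ContDiff.contDiffOn ?_)
    fun_prop
  have hΨ : ∀ y ∈ O, ContDiffAt ℝ ∞ Ψ y := fun y hy => hΨO.contDiffAt (hO.mem_nhds hy)
  have hΨx : HasFDerivAt Ψ (A : E d →L[ℝ] ℝ × E (d - 1)) x := by
    have h1 : HasFDerivAt σ (fderiv ℝ σ x) x :=
      ((hσ.contDiffAt (hO.mem_nhds hxO)).differentiableAt (by simp)).hasFDerivAt
    have h2 : HasFDerivAt (fun y : E d => (A (y - x)).2)
        ((ContinuousLinearMap.snd ℝ ℝ (E (d - 1))).comp (A : E d →L[ℝ] ℝ × E (d - 1))) x := by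
      have h3 : HasFDerivAt (fun y : E d => y - x) (ContinuousLinearMap.id ℝ (E d)) x :=
        (hasFDerivAt_id x).sub_const x
      exact ((ContinuousLinearMap.snd ℝ ℝ (E (d - 1))).comp
        (A : E d →L[ℝ] ℝ × E (d - 1))).hasFDerivAt.comp x h3
    refine (h1.prodMk h2).congr_fderiv ?_
    ext v
    · simp [hA]
    · simp
  let P := (hΨ x hxO).toOpenPartialHomeomorph Ψ hΨx (by simp)
  have hPc : ∀ y, P y = Ψ y := fun y => rfl
  have hxP : x ∈ P.source := (hΨ x hxO).mem_toOpenPartialHomeomorph_source hΨx (by simp)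
  let R : Set (E d →L[ℝ] ℝ × E (d - 1)) := range ((↑) : (E d ≃L[ℝ] ℝ × E (d - 1)) → _)
  -- Smoothness of `P.symm` needs an invertible derivative of `Ψ` at each point used, not only at
  -- `x`.
  let Ω : Set (E d) := P.source ∩ (O ∩ fderiv ℝ Ψ ⁻¹' R)
  have hΩ : IsOpen Ω := by
    refine P.open_source.inter (ContinuousOn.isOpen_inter_preimage ?_ hO ContinuousLinearEquiv.isOpen)
    exact hΨO.continuousOn_fderiv_of_isOpen hO (by simp)
  have hxΩ : x ∈ Ω := ⟨hxP, hxO, A, hΨx.fderiv.symm⟩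
  let T : Set (ℝ × E (d - 1)) := P.target ∩ P.symm ⁻¹' Ω
  have hT : IsOpen T := P.symm.isOpen_inter_preimage hΩ
  let W : Set (E (d - 1)) := (fun u => ((0 : ℝ), u)) ⁻¹' T
  let φ : E (d - 1) → E d := fun u => P.symm (0, u)
  have hW : IsOpen W := hT.preimage (by fun_prop)
  have hΨx0 : Ψ x = (0, 0) := by simp [hΨdef, (hS' hxO).1 hxS]
  have hφ0 : φ 0 = x := by
    have := P.left_inv hxP
    rwa [hPc, hΨx0] at this
  have h0W : (0 : E (d - 1)) ∈ W := by
    refine ⟨?_, ?_⟩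
    · have := P.map_source hxP
      rwa [hPc, hΨx0] at this
    · change φ 0 ∈ Ω
      rwa [hφ0]
  have hφΩ : ∀ u ∈ W, φ u ∈ Ω := fun u hu => hu.2
  have hΨφ : ∀ u ∈ W, Ψ (φ u) = (0, u) := fun u hu => P.right_inv hu.1
  have hσφ : ∀ u ∈ W, σ (φ u) = 0 := fun u hu => congrArg Prod.fst (hΨφ u hu)
  have hπφ : ∀ u ∈ W, (A (φ u - x)).2 = u := fun u hu => congrArg Prod.snd (hΨφ u hu)
  have hφs : ∀ u ∈ W, ContDiffAt ℝ ∞ φ u := by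
    intro u hu
    obtain ⟨-, hyO, B, hB⟩ := hφΩ u hu
    have h1 : HasFDerivAt P (B : E d →L[ℝ] ℝ × E (d - 1)) (P.symm (0, u)) := by
      rw [hB]
      exact ((hΨ _ hyO).differentiableAt (by simp)).hasFDerivAt
    have h2 : ContDiffAt ℝ ∞ P.symm (0, u) := P.contDiffAt_symm hu.1 h1 (hΨ _ hyO)
    exact h2.comp u (contDiffAt_const.prodMk contDiffAt_id)
  -- The second component of `A (· - x)` is a smooth left inverse of `φ`; it yields both the
  -- immersion and the embedding property.
  have hπd : ∀ u ∈ W, ∀ w, (A (fderiv ℝ φ u w)).2 = w := by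
    intro u hu w
    have h1 : HasFDerivAt (fun u => (A (φ u - x)).2)
        (((ContinuousLinearMap.snd ℝ ℝ (E (d - 1))).comp
          (A : E d →L[ℝ] ℝ × E (d - 1))).comp (fderiv ℝ φ u)) u :=
      ((ContinuousLinearMap.snd ℝ ℝ (E (d - 1))).comp
        (A : E d →L[ℝ] ℝ × E (d - 1))).hasFDerivAt.comp u
        (((hφs u hu).differentiableAt (by simp)).hasFDerivAt.sub_const x)
    have h2 : (fun u => (A (φ u - x)).2) =ᶠ[𝓝 u] id := by
      filter_upwards [hW.mem_nhds hu] with y hy using hπφ y hy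
    have h3 := h1.unique ((hasFDerivAt_id u).congr_of_eventuallyEq h2)
    simpa using DFunLike.congr_fun h3 w
  have hσd : ∀ w, fderiv ℝ σ x (fderiv ℝ φ 0 w) = 0 := by
    intro w
    have h1 : HasFDerivAt σ (fderiv ℝ σ x) (φ 0) := by
      rw [hφ0]
      exact ((hσ.contDiffAt (hO.mem_nhds hxO)).differentiableAt (by simp)).hasFDerivAt
    have h2 := h1.comp 0 ((hφs 0 h0W).differentiableAt (by simp)).hasFDerivAt
    have h3 : σ ∘ φ =ᶠ[𝓝 0] fun _ => 0 := by
      filter_upwards [hW.mem_nhds h0W] with y hy using hσφ y hy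
    have h4 := h2.unique ((hasFDerivAt_const (0 : ℝ) _).congr_of_eventuallyEq h3)
    simpa using DFunLike.congr_fun h4 w
  refine ⟨W, φ, ⟨hW, h0W, hφ0, fun u hu => (hφs u hu).contDiffWithinAt, ?_, ?_, Ω, hΩ, ?_⟩,
    hσφ, hσd, fun v hv => ⟨(A v).2, A.injective (Prod.ext ?_ ?_)⟩⟩
  · intro u hu w₁ w₂ h
    rw [← hπd u hu w₁, ← hπd u hu w₂, h]
  · have hcomp : (fun y : E d => (A (y - x)).2) ∘ W.domRestrict φ = ((↑) : W → E (d - 1)) :=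
      funext fun u => hπφ u u.2
    refine Topology.IsEmbedding.of_comp ?_ ?_ (hcomp ▸ Topology.IsEmbedding.subtypeVal)
    · exact continuousOn_iff_continuous_domRestrict.1
        fun u hu => (hφs u hu).continuousAt.continuousWithinAt
    · fun_prop
  · ext y
    constructor
    · rintro ⟨u, hu, rfl⟩
      exact ⟨(hS' (hφΩ u hu).2.1).2 (hσφ u hu), hφΩ u hu⟩
    · rintro ⟨hyS, hyΩ⟩
      have hy0 : Ψ y = (0, (A (y - x)).2) := Prod.ext ((hS' hyΩ.2.1).1 hyS) rfl
      have hleft := P.left_inv hyΩ.1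
      rw [hPc, hy0] at hleft
      refine ⟨(A (y - x)).2, ⟨?_, ?_⟩, hleft⟩
      · have := P.map_source hyΩ.1
        rwa [hPc, hy0] at this
      · change P.symm _ ∈ Ω
        rwa [hleft]
  · rw [hA, hA, hσd, hv]
  · exact hπd 0 h0W _

/-- Vectors in the image of the differential of a local parametrization are tangent. -/
theorem IsLocalParam.fderiv_mem_tangentSpace {n d : ℕ} {S : Set (E d)} {x : E d} {W : Set (E n)}
    {φ : E n → E d} (h : IsLocalParam S x W φ) (u : E n) :
    fderiv ℝ φ 0 u ∈ tangentSpace S x := by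
  refine Submodule.subset_span ?_
  have hc : Continuous fun t : ℝ => t • u := by fun_prop
  obtain ⟨ε, hε, hball⟩ := Metric.isOpen_iff.1 (h.isOpen.preimage hc) 0
    (by simpa using h.zero_mem)
  rw [Real.ball_eq_Ioo, zero_sub, zero_add] at hball
  obtain ⟨U, -, hU⟩ := h.image_eq
  refine ⟨ε, fun t => φ (t • u), hε, ?_, fun t ht => ?_, by simp [h.map_zero], ?_⟩
  · exact h.contDiffOn.comp (by fun_prop : ContDiff ℝ ∞ fun t : ℝ => t • u).contDiffOn hball
  · exact (hU ▸ mem_image_of_mem φ (hball ht) : φ (t • u) ∈ S ∩ U).1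
  · have h1 : HasFDerivAt φ (fderiv ℝ φ 0) ((0 : ℝ) • u) := by
      rw [zero_smul]
      exact ((h.contDiffOn.contDiffAt (h.isOpen.mem_nhds h.zero_mem)).differentiableAt
        (by simp)).hasFDerivAt
    have h2 : HasDerivAt (fun t : ℝ => t • u) u 0 := by
      simpa using (hasDerivAt_id (0 : ℝ)).smul_const u
    exact (h1.comp_hasDerivAt 0 h2).deriv

/-- Nondegeneracy of the Hessian is a local property of the hypersurface. -/
theorem HasNondegenerateHessian.of_inter_eq {d : ℕ} {f : E d → ℝ} {S S' O : Set (E d)} {x : E d}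
    (hO : IsOpen O) (hx : x ∈ O) (hS : S ∩ O = S' ∩ O) (h : HasNondegenerateHessian f S x) :
    HasNondegenerateHessian f S' x := by
  obtain ⟨W, φ, hφ, hH⟩ := h
  obtain ⟨U, hU, hWU⟩ := hφ.image_eq
  refine ⟨W ∩ φ ⁻¹' O, φ, ⟨?_, ⟨hφ.zero_mem, by simpa [hφ.map_zero] using hx⟩, hφ.map_zero,
    hφ.contDiffOn.mono inter_subset_left, fun y hy => hφ.injective_fderiv y hy.1, ?_,
    U ∩ O, hU.inter hO, ?_⟩, hH⟩
  · exact hφ.contDiffOn.continuousOn.isOpen_inter_preimage hφ.isOpen hO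
  · exact hφ.isEmbedding.comp (Topology.IsEmbedding.inclusion inter_subset_left)
  · rw [image_inter_preimage, hWU]
    have h1 := Set.ext_iff.1 hS
    ext y
    have := h1 y
    simp only [mem_inter_iff] at this ⊢
    tauto

/-! ### A global defining function. -/

/-- The local defining functions of an open set with compact smooth boundary can be glued to one
defining function, smooth on the whole space. -/
theorem exists_contDiff_isDefiningFunctionOn {d : ℕ} {D : Set (E d)} (hD : IsOpen D)
    (hK : IsCompact (frontier D))
    (hloc : ∀ x ∈ frontier D, ∃ (U : Set (E d)) (ρ : E d → ℝ),
      IsOpen U ∧ x ∈ U ∧ IsDefiningFunctionOn D U ρ) :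
    ∃ (W : Set (E d)) (ρ : E d → ℝ), IsOpen W ∧ frontier D ⊆ W ∧ ContDiff ℝ ∞ ρ ∧
      IsDefiningFunctionOn D W ρ := by
  choose U r hU hxU hr using fun x : frontier D => hloc x x.2
  choose χ hχU hχc hχs hχr hχ1 using fun x : frontier D =>
    exists_contDiff_tsupport_subset (n := ⊤) ((hU x).mem_nhds (hxU x))
  have hχ0 : ∀ x y, 0 ≤ χ x y := fun x y => (hχr x (mem_range_self y)).1
  have hχU' : ∀ {x y}, χ x y ≠ 0 → y ∈ U x := fun {x y} h =>
    hχU x (subset_tsupport _ h)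
  have hs : ∀ x, ContDiff ℝ ∞ fun y => χ x y * r x y := by
    intro x
    refine contDiff_iff_contDiffAt.2 fun y => ?_
    by_cases hy : y ∈ U x
    · exact (hχs x).contDiffAt.mul ((hr x).contDiffAt (hU x) hy)
    · have h1 : ∀ᶠ z in 𝓝 y, χ x z = 0 := notMem_tsupport_iff_eventuallyEq.1 fun h => hy (hχU x h)
      exact (contDiffAt_const (c := (0 : ℝ))).congr_of_eventuallyEq (h1.mono fun z hz => by simp [hz])
  -- On the boundary `r x` vanishes, so the product rule loses the derivative of the cutoff.
  have hd : ∀ x, ∀ y ∈ frontier D, ∀ v,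
      fderiv ℝ (fun y => χ x y * r x y) y v = χ x y * fderiv ℝ (r x) y v := by
    intro x y hyD v
    by_cases hy : y ∈ U x
    · rw [fderiv_fun_mul ((hχs x).differentiable (by simp) y) ((hr x).differentiableAt (hU x) hy)]
      simp [((hr x).mem_frontier_iff hD (hU x) hy).1 hyD]
    · have h1 : ∀ᶠ z in 𝓝 y, χ x z = 0 := notMem_tsupport_iff_eventuallyEq.1 fun h => hy (hχU x h)
      have h2 : (fun y => χ x y * r x y) =ᶠ[𝓝 y] fun _ => 0 := h1.mono fun z hz => by simp [hz]
      rw [h2.fderiv_eq, h1.self_of_nhds]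
      simp
  obtain ⟨t, ht⟩ := hK.elim_nhds_subcover' (fun x hx => {y | 0 < χ ⟨x, hx⟩ y}) fun x hx =>
    ((hχs ⟨x, hx⟩).continuous.continuousAt.eventually (lt_mem_nhds (by rw [hχ1]; exact one_pos)))
  set ρ : E d → ℝ := fun y => ∑ x ∈ t, χ x y * r x y with hρ
  have hρs : ContDiff ℝ ∞ ρ := ContDiff.sum fun x _ => hs x
  have hρd : ∀ y ∈ frontier D, ∀ v, fderiv ℝ ρ y v = ∑ x ∈ t, χ x y * fderiv ℝ (r x) y v := by
    intro y hy v
    rw [hρ, fderiv_fun_sum fun x _ => (hs x).differentiable (by simp) y]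
    rw [sum_apply]
    exact Finset.sum_congr rfl fun x _ => hd x y hy v
  let W₀ : Set (E d) := ⋃ x ∈ t, {y | 0 < χ x y}
  have hW₀ : IsOpen W₀ := isOpen_biUnion fun x _ => isOpen_lt continuous_const (hχs x).continuous
  refine ⟨W₀ ∩ {y | fderiv ℝ ρ y ≠ 0}, ρ, hW₀.inter ?_, fun y hy => ⟨ht hy, ?_⟩, hρs,
    hρs.contDiffOn, fun y hy => hy.2, ?_⟩
  · exact isOpen_ne_fun (hρs.continuous_fderiv (by simp)) continuous_const
  · obtain ⟨x, hxt, hxy⟩ := mem_iUnion₂.1 (ht hy)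
    have hxy : 0 < χ x y := hxy
    have hyU := hχU' hxy.ne'
    -- The differentials of all local defining functions have compatible signs on `v`, so nothing
    -- cancels in the sum.
    obtain ⟨v, hv⟩ : ∃ v, 0 < fderiv ℝ (r x) y v := by
      obtain ⟨v, hv⟩ : ∃ v, fderiv ℝ (r x) y v ≠ 0 := by
        by_contra! hall
        exact (hr x).fderiv_ne_zero y hyU (ContinuousLinearMap.ext hall)
      rcases lt_or_gt_of_ne hv with hv | hv
      · exact ⟨-v, by simpa using hv⟩
      · exact ⟨v, hv⟩
    have hpos : 0 < fderiv ℝ ρ y v := by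
      rw [hρd y hy]
      refine Finset.sum_pos' (fun x' _ => ?_) ⟨x, hxt, mul_pos hxy hv⟩
      by_cases h0 : χ x' y = 0
      · simp [h0]
      · exact mul_nonneg (hχ0 x' y)
          ((hr x).fderiv_nonneg hD (hU x) (hr x') (hU x') hyU (hχU' h0) hy hv)
    intro h0
    simp [h0] at hpos
  · ext y
    constructor
    · rintro ⟨hyD, hyW⟩
      refine ⟨hyW, ?_⟩
      obtain ⟨x, hxt, hxy⟩ := mem_iUnion₂.1 hyW.1
      have hxy : 0 < χ x y := hxy
      refine Finset.sum_neg' (fun x' _ => ?_)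
        ⟨x, hxt, mul_neg_of_pos_of_neg hxy (((hr x).neg_iff (hχU' hxy.ne')).2 hyD)⟩
      by_cases h0 : χ x' y = 0
      · simp [h0]
      · exact mul_nonpos_of_nonneg_of_nonpos (hχ0 x' y)
          (((hr x').neg_iff (hχU' h0)).2 hyD).le
    · rintro ⟨hyW, hneg⟩
      refine ⟨?_, hyW⟩
      by_contra hyD
      refine hneg.not_ge (Finset.sum_nonneg fun x' _ => ?_)
      by_cases h0 : χ x' y = 0
      · simp [h0]
      · exact mul_nonneg (hχ0 x' y)
          (not_lt.1 fun h => hyD (((hr x').neg_iff (hχU' h0)).1 h))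

/-! ### Genericity of affine perturbations. -/

/-- **Sard's theorem in equal dimensions**: regular values are dense. -/
theorem dense_regularValues {X Y : Type*} [NormedAddCommGroup X] [NormedSpace ℝ X]
    [FiniteDimensional ℝ X] [NormedAddCommGroup Y] [NormedSpace ℝ Y] [FiniteDimensional ℝ Y]
    (hXY : Module.finrank ℝ X = Module.finrank ℝ Y) {P : X → Y} (hP : Differentiable ℝ P) :
    Dense {y | ∀ x, P x = y → Function.Injective (fderiv ℝ P x)} := by
  borelize X
  let e : Y ≃L[ℝ] X := ContinuousLinearEquiv.ofFinrankEq hXY.symm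
  let s : Set X := {x | ((e : Y →L[ℝ] X).comp (fderiv ℝ P x)).det = 0}
  have hnull : (MeasureTheory.Measure.addHaar : MeasureTheory.Measure X) ((e ∘ P) '' s) = 0 :=
    MeasureTheory.addHaar_image_eq_zero_of_det_fderivWithin_eq_zero _
      (fun x _ => (((e : Y →L[ℝ] X).hasFDerivAt.comp x (hP x).hasFDerivAt).hasFDerivWithinAt))
      fun x hx => hx
  have hdense : Dense {z | z ∉ (e ∘ P) '' s} :=
    MeasureTheory.Measure.dense_of_ae (MeasureTheory.measure_eq_zero_iff_ae_notMem.1 hnull)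
  refine (hdense.preimage e.toHomeomorph.isOpenMap).mono ?_
  rintro y hy x rfl
  have hx : ((e : Y →L[ℝ] X).comp (fderiv ℝ P x)).det ≠ 0 := fun h => hy ⟨x, h, rfl⟩
  have hinj : Function.Injective ((e : Y →L[ℝ] X).comp (fderiv ℝ P x)) :=
    (LinearMap.equivOfDetNeZero _ hx).injective
  exact Function.Injective.of_comp (f := e) hinj

/-- For a dense set of affine functions `q + c`, the critical points of `f` on the level set
`{ρ + q + c = 0}` satisfy the second order nondegeneracy condition of the Lagrange multiplier
rule. -/
theorem dense_nondegenerate_affine {V : Type*} [NormedAddCommGroup V] [NormedSpace ℝ V]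
    [FiniteDimensional ℝ V] {f ρ : V → ℝ} (hf : ContDiff ℝ ∞ f) (hρ : ContDiff ℝ ∞ ρ) :
    Dense {p : (V →L[ℝ] ℝ) × ℝ | ∀ (x : V) (μ : ℝ), fderiv ℝ ρ x + p.1 = μ • fderiv ℝ f x →
      ρ x + (p.1 x + p.2) = 0 → ∀ (v : V) (ν : ℝ), fderiv ℝ ρ x v + p.1 v = 0 →
        ν • fderiv ℝ f x + μ • fderiv ℝ (fderiv ℝ f) x v - fderiv ℝ (fderiv ℝ ρ) x v = 0 →
        v = 0} := by
  -- `P (x, μ) = (q, c)` says exactly that `x` lies on `{ρ + q + c = 0}` and is critical there with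
  -- multiplier `μ`. A pair `(v, ν)` as in the second order condition is then in the kernel of the
  -- derivative of `P`, so it vanishes when `(q, c)` is a regular value.
  let G : V × ℝ → V →L[ℝ] ℝ := fun z => z.2 • fderiv ℝ f z.1 - fderiv ℝ ρ z.1
  let P : V × ℝ → (V →L[ℝ] ℝ) × ℝ := fun z => (G z, -ρ z.1 - G z z.1)
  have hf1 : Differentiable ℝ (fderiv ℝ f) :=
    (hf.fderiv_right (m := ∞) (by simp)).differentiable (by simp)
  have hρ1 : Differentiable ℝ (fderiv ℝ ρ) :=
    (hρ.fderiv_right (m := ∞) (by simp)).differentiable (by simp)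
  have hρ0 : Differentiable ℝ ρ := hρ.differentiable (by simp)
  have hG : ∀ x μ v ν, HasFDerivAt G (fderiv ℝ G (x, μ)) (x, μ) ∧ fderiv ℝ G (x, μ) (v, ν) =
      ν • fderiv ℝ f x + μ • fderiv ℝ (fderiv ℝ f) x v - fderiv ℝ (fderiv ℝ ρ) x v := by
    intro x μ v ν
    have h1 : HasFDerivAt (fun z : V × ℝ => z.1) (ContinuousLinearMap.fst ℝ V ℝ) (x, μ) :=
      hasFDerivAt_fst
    have h2 : HasFDerivAt (fun z : V × ℝ => z.2) (ContinuousLinearMap.snd ℝ V ℝ) (x, μ) :=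
      hasFDerivAt_snd
    have h3 := (hf1 x).hasFDerivAt.comp (x, μ) h1
    have h4 := (hρ1 x).hasFDerivAt.comp (x, μ) h1
    have h5 : HasFDerivAt G _ (x, μ) := (h2.smul h3).sub h4
    refine ⟨h5.differentiableAt.hasFDerivAt, ?_⟩
    rw [h5.fderiv]
    simp [add_comm]
  have hP : ∀ x μ v ν, HasFDerivAt P (fderiv ℝ P (x, μ)) (x, μ) ∧ fderiv ℝ P (x, μ) (v, ν) =
      (fderiv ℝ G (x, μ) (v, ν),
        -fderiv ℝ ρ x v - (fderiv ℝ G (x, μ) (v, ν) x + G (x, μ) v)) := by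
    intro x μ v ν
    have h0 := (hG x μ v ν).1
    have h1 : HasFDerivAt (fun z : V × ℝ => z.1) (ContinuousLinearMap.fst ℝ V ℝ) (x, μ) :=
      hasFDerivAt_fst
    have h2 := (hρ0 x).hasFDerivAt.comp (x, μ) h1
    have h5 : HasFDerivAt P _ (x, μ) := h0.prodMk (h2.neg.sub (h0.clm_apply h1))
    refine ⟨h5.differentiableAt.hasFDerivAt, ?_⟩
    rw [h5.fderiv]
    simp [add_comm]
  have hfin : Module.finrank ℝ (V × ℝ) = Module.finrank ℝ ((V →L[ℝ] ℝ) × ℝ) := by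
    rw [Module.finrank_prod, Module.finrank_prod]
    congr 1
    rw [← LinearMap.toContinuousLinearMap.finrank_eq]
    exact (Subspace.dual_finrank_eq (K := ℝ) (V := V)).symm
  refine (dense_regularValues hfin fun z => (hP z.1 z.2 0 0).1.differentiableAt).mono ?_
  rintro ⟨q, c⟩ hp x μ hq hc v ν hv hνv
  have hGx : G (x, μ) = q := by
    simp only [G, ← hq, add_sub_cancel_left]
  have hPx : P (x, μ) = (q, c) := by
    refine Prod.ext hGx ?_
    simp only [P, hGx]
    simp only at hc
    linarith
  have hinj := hp (x, μ) hPx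
  have h0 : fderiv ℝ P (x, μ) (v, ν) = 0 := by
    rw [(hP x μ v ν).2, (hG x μ v ν).2, hνv, hGx]
    simp only [zero_apply, zero_add, Prod.mk_eq_zero, true_and]
    simp only at hv
    linarith
  exact congrArg Prod.fst (hinj (h0.trans (map_zero _).symm) : (v, ν) = 0)

/-! ### The second order Lagrange criterion. -/

/-- A linear form vanishing on the kernel of another one is a multiple of it. -/
theorem exists_eq_smul_of_ker_le {V : Type*} [NormedAddCommGroup V] [NormedSpace ℝ V]
    {g h : V →L[ℝ] ℝ} (hle : ∀ v, g v = 0 → h v = 0) : ∃ c : ℝ, h = c • g := by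
  by_cases hg : g = 0
  · exact ⟨0, ContinuousLinearMap.ext fun v => by simp [hle v (by simp [hg])]⟩
  obtain ⟨v, hv⟩ : ∃ v, g v ≠ 0 := by
    by_contra! hall
    exact hg (ContinuousLinearMap.ext hall)
  refine ⟨h v / g v, ContinuousLinearMap.ext fun w => ?_⟩
  have := hle (w - (g w / g v) • v) (by simp [hv])
  simp only [map_sub, map_smul, smul_eq_mul, sub_eq_zero] at this
  simp only [smul_apply, smul_eq_mul, this]
  ring

/-- The second order Lagrange multiplier criterion for the nondegeneracy of the Hessian of the
restriction of a function to a level set. -/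
theorem hasNondegenerateHessian_of_lagrange {d : ℕ} {S O : Set (E d)} {f σ : E d → ℝ} {x : E d}
    (hf : ContDiff ℝ ∞ f) (hO : IsOpen O) (hσ : ContDiffOn ℝ ∞ σ O)
    (hS : S ∩ O = {y ∈ O | σ y = 0}) (hxS : x ∈ S) (hxO : x ∈ O) (hx : fderiv ℝ σ x ≠ 0) {μ : ℝ}
    (hμ : fderiv ℝ σ x = μ • fderiv ℝ f x)
    (hnd : ∀ (v : E d) (ν : ℝ), fderiv ℝ σ x v = 0 →
      ν • fderiv ℝ f x + μ • fderiv ℝ (fderiv ℝ f) x v - fderiv ℝ (fderiv ℝ σ) x v = 0 → v = 0) :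
    HasNondegenerateHessian f S x := by
  obtain ⟨W, φ, hφ, hσφ, hσd, hker⟩ := exists_isLocalParam hO hσ hS hxS hxO hx
  refine ⟨W, φ, hφ, fun u hu => ?_⟩
  have hWn : W ∈ 𝓝 (0 : E (d - 1)) := hφ.isOpen.mem_nhds hφ.zero_mem
  have hφs : ∀ y ∈ W, ContDiffAt ℝ ∞ φ y := fun y hy =>
    hφ.contDiffOn.contDiffAt (hφ.isOpen.mem_nhds hy)
  have hσs : ∀ y ∈ O, ContDiffAt ℝ ∞ σ y := fun y hy => hσ.contDiffAt (hO.mem_nhds hy)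
  -- The Lagrangian is critical at `x`, so the second derivative of `F ∘ φ` at 0 contains no second
  -- derivative of `φ`. As `σ ∘ φ = 0`, it is also `μ` times that of `f ∘ φ`.
  let F : E d → ℝ := fun y => μ * f y - σ y
  have hFs : ∀ y ∈ O, ContDiffAt ℝ ∞ F y := fun y hy =>
    (contDiffAt_const.mul hf.contDiffAt).sub (hσs y hy)
  have hF1 : ∀ y ∈ O, fderiv ℝ F y = μ • fderiv ℝ f y - fderiv ℝ σ y := by
    intro y hy
    have h1 := ((hf.differentiable (by simp) y).hasFDerivAt.const_mul μ).sub
      ((hσs y hy).differentiableAt (by simp)).hasFDerivAt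
    exact h1.fderiv
  have hF0 : fderiv ℝ F (φ 0) = 0 := by rw [hφ.map_zero, hF1 x hxO, hμ, sub_self]
  have hF2 : fderiv ℝ (fderiv ℝ F) x = μ • fderiv ℝ (fderiv ℝ f) x - fderiv ℝ (fderiv ℝ σ) x := by
    have h1 : fderiv ℝ F =ᶠ[𝓝 x] fun y => μ • fderiv ℝ f y - fderiv ℝ σ y := by
      filter_upwards [hO.mem_nhds hxO] with y hy using hF1 y hy
    have h2 : DifferentiableAt ℝ (fderiv ℝ f) x :=
      (hf.fderiv_right (m := ∞) (by simp)).differentiable (by simp) x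
    have h3 : DifferentiableAt ℝ (fderiv ℝ σ) x :=
      ((hσs x hxO).fderiv_right (m := ∞) (by simp)).differentiableAt (by simp)
    rw [h1.fderiv_eq]
    exact ((h2.hasFDerivAt.const_smul μ).sub h3.hasFDerivAt).fderiv
  have hφO : ∀ᶠ y in 𝓝 (0 : E (d - 1)), φ y ∈ O :=
    (hφs 0 hφ.zero_mem).continuousAt.eventually (by rw [hφ.map_zero]; exact hO.mem_nhds hxO)
  have hcomp : fderiv ℝ (F ∘ φ) =ᶠ[𝓝 0] fun y => (fderiv ℝ F (φ y)).comp (fderiv ℝ φ y) := by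
    filter_upwards [hWn, hφO] with y hy hyO
    exact fderiv_comp y ((hFs _ hyO).differentiableAt (by simp))
      ((hφs y hy).differentiableAt (by simp))
  have hFf : F ∘ φ =ᶠ[𝓝 0] fun y => μ * (f ∘ φ) y := by
    filter_upwards [hWn] with y hy
    simp [F, hσφ y hy]
  have hFf1 : fderiv ℝ (F ∘ φ) =ᶠ[𝓝 0] fun y => μ • fderiv ℝ (f ∘ φ) y := by
    filter_upwards [hFf.eventuallyEq_nhds, hWn] with y hy hyW
    rw [hy.fderiv_eq]
    exact ((hf.differentiable (by simp) _).comp y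
      ((hφs y hyW).differentiableAt (by simp))).hasFDerivAt.const_mul μ |>.fderiv
  have hfφ : DifferentiableAt ℝ (fderiv ℝ (f ∘ φ)) 0 :=
    ((hf.contDiffAt.comp 0 (hφs 0 hφ.zero_mem)).fderiv_right (m := ∞) (by simp)).differentiableAt
      (by simp)
  have hder1 : fderiv ℝ (fderiv ℝ (F ∘ φ)) 0 = μ • fderiv ℝ (fderiv ℝ (f ∘ φ)) 0 := by
    rw [hFf1.fderiv_eq]
    exact (hfφ.hasFDerivAt.const_smul μ).fderiv
  have hder2 : ∀ w, fderiv ℝ (fderiv ℝ (F ∘ φ)) 0 u w =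
      fderiv ℝ (fderiv ℝ F) x (fderiv ℝ φ 0 u) (fderiv ℝ φ 0 w) := by
    intro w
    have h1 : HasFDerivAt (fderiv ℝ F) (fderiv ℝ (fderiv ℝ F) x) (φ 0) := by
      rw [hφ.map_zero]
      exact (((hFs x hxO).fderiv_right (m := ∞) (by simp)).differentiableAt (by simp)).hasFDerivAt
    have h2 := h1.comp 0 ((hφs 0 hφ.zero_mem).differentiableAt (by simp)).hasFDerivAt
    have h3 : HasFDerivAt (fderiv ℝ φ) (fderiv ℝ (fderiv ℝ φ) 0) 0 :=
      (((hφs 0 hφ.zero_mem).fderiv_right (m := ∞) (by simp)).differentiableAt (by simp)).hasFDerivAt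
    have h4 : HasFDerivAt (fun y => (fderiv ℝ F (φ y)).comp (fderiv ℝ φ y)) _ 0 := h2.clm_comp h3
    rw [hcomp.fderiv_eq, h4.fderiv]
    simp [hF0]
  have hμ0 : μ ≠ 0 := fun h0 => hx (by rw [hμ, h0, zero_smul])
  -- The Hessian of `F` applied to the image of `u` vanishes on the kernel of `df`, hence is a
  -- multiple of `df`; `ν = -c` absorbs it in `hnd`.
  obtain ⟨c, hc⟩ : ∃ c : ℝ, fderiv ℝ (fderiv ℝ F) x (fderiv ℝ φ 0 u) = c • fderiv ℝ f x := by
    refine exists_eq_smul_of_ker_le fun v hv => ?_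
    obtain ⟨w, rfl⟩ := hker v (by rw [hμ, smul_apply, hv, smul_zero])
    rw [← hder2, hder1, smul_apply, smul_apply, hu, smul_zero]
  have hv := hnd (fderiv ℝ φ 0 u) (-c) (hσd u) (by
    rw [hF2, sub_apply, smul_apply] at hc
    rw [add_sub_assoc, hc, neg_smul, neg_add_cancel])
  exact hφ.injective_fderiv 0 hφ.zero_mem (hv.trans (map_zero _).symm)

/-! ### Cut-off affine perturbations. -/

section Perturbation

variable {V : Type*} [NormedAddCommGroup V] [NormedSpace ℝ V]

/-- The perturbation of `ρ` by an affine function cut off by `χ`. -/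
def affinePerturbation (ρ χ : V → ℝ) (p : (V →L[ℝ] ℝ) × ℝ) (y : V) : ℝ :=
  ρ y + χ y * (p.1 y + p.2)

variable {ρ χ : V → ℝ}

@[simp]
theorem affinePerturbation_zero : affinePerturbation ρ χ 0 = ρ := by
  ext y
  simp [affinePerturbation]

theorem contDiff_uncurry_affinePerturbation (hρ : ContDiff ℝ ∞ ρ) (hχ : ContDiff ℝ ∞ χ) :
    ContDiff ℝ ∞ fun z : ((V →L[ℝ] ℝ) × ℝ) × V => affinePerturbation ρ χ z.1 z.2 :=
  (hρ.comp contDiff_snd).add ((hχ.comp contDiff_snd).mul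
    ((contDiff_fst.fst.clm_apply contDiff_snd).add contDiff_fst.snd))

theorem contDiff_affinePerturbation (hρ : ContDiff ℝ ∞ ρ) (hχ : ContDiff ℝ ∞ χ)
    (p : (V →L[ℝ] ℝ) × ℝ) : ContDiff ℝ ∞ (affinePerturbation ρ χ p) :=
  (contDiff_uncurry_affinePerturbation hρ hχ).comp (contDiff_const.prodMk contDiff_id)

/-- Continuity jointly in the parameter and the point lets compactness turn conditions at parameter
0 into conditions uniform over the support of `χ`. -/
theorem continuous_fderiv_affinePerturbation (hρ : ContDiff ℝ ∞ ρ) (hχ : ContDiff ℝ ∞ χ) :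
    Continuous fun z : ((V →L[ℝ] ℝ) × ℝ) × V => fderiv ℝ (affinePerturbation ρ χ z.1) z.2 := by
  have h1 : ContDiff ℝ ∞ (Function.uncurry fun (z : ((V →L[ℝ] ℝ) × ℝ) × V) (y : V) =>
      affinePerturbation ρ χ z.1 y) :=
    (contDiff_uncurry_affinePerturbation hρ hχ).comp (contDiff_fst.fst.prodMk contDiff_snd)
  exact (h1.fderiv (n := ∞) contDiff_snd (by simp)).continuous

theorem affinePerturbation_eventuallyEq_of_notMem {x : V} (hx : x ∉ tsupport χ)
    (p : (V →L[ℝ] ℝ) × ℝ) : affinePerturbation ρ χ p =ᶠ[𝓝 x] ρ := by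
  filter_upwards [notMem_tsupport_iff_eventuallyEq.1 hx] with y hy
  simp [affinePerturbation, hy]

/-- Not being proportional to `df` is an open condition on the differential of the perturbation. -/
theorem eventually_fderiv_affinePerturbation_ne_smul {f : V → ℝ} (hf : ContDiff ℝ ∞ f)
    (hρ : ContDiff ℝ ∞ ρ) (hχ : ContDiff ℝ ∞ χ) {y : V} (hfy : fderiv ℝ f y ≠ 0)
    (hy : ∀ μ : ℝ, fderiv ℝ ρ y ≠ μ • fderiv ℝ f y) :
    ∀ᶠ z : ((V →L[ℝ] ℝ) × ℝ) × V in 𝓝 (0, y),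
      ∀ μ : ℝ, fderiv ℝ (affinePerturbation ρ χ z.1) z.2 ≠ μ • fderiv ℝ f z.2 := by
  obtain ⟨w, hw⟩ : ∃ w, fderiv ℝ f y w ≠ 0 := by
    by_contra! hall
    exact hfy (ContinuousLinearMap.ext hall)
  obtain ⟨v, hfv, hv⟩ : ∃ v, fderiv ℝ f y v = 0 ∧ fderiv ℝ ρ y v ≠ 0 := by
    by_contra! hall
    obtain ⟨c, hc⟩ := exists_eq_smul_of_ker_le hall
    exact hy c hc
  have hR := continuous_fderiv_affinePerturbation hρ hχ
  have hF : Continuous fun z : ((V →L[ℝ] ℝ) × ℝ) × V => fderiv ℝ f z.2 :=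
    (hf.continuous_fderiv (by simp)).comp continuous_snd
  -- This 2×2 minor vanishes whenever the perturbed differential is a multiple of `df`, but is
  -- nonzero at `(0, y)`.
  have hc : Continuous fun z : ((V →L[ℝ] ℝ) × ℝ) × V =>
      fderiv ℝ f z.2 v * fderiv ℝ (affinePerturbation ρ χ z.1) z.2 w -
        fderiv ℝ f z.2 w * fderiv ℝ (affinePerturbation ρ χ z.1) z.2 v := by
    fun_prop
  have h0 := hc.continuousAt.eventually_ne (x := (0, y)) (y := 0) (by simp [hfv, hv, hw])
  filter_upwards [h0] with z hz μ hμ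
  refine hz ?_
  rw [hμ, smul_apply, smul_apply, smul_eq_mul, smul_eq_mul]
  ring

/-- The region gained by a small perturbation is connected to the original region. -/
theorem eventually_exists_isPreconnected (hρ : ContDiff ℝ ∞ ρ) (hχ : ContDiff ℝ ∞ χ)
    {W : Set V} (hW : IsOpen W) {y₀ : V} (hy₀ : y₀ ∈ W) (hd : fderiv ℝ ρ y₀ ≠ 0) :
    ∀ᶠ z : ((V →L[ℝ] ℝ) × ℝ) × V in 𝓝 (0, y₀), affinePerturbation ρ χ z.1 z.2 < 0 →
      ∃ C : Set V, IsPreconnected C ∧ z.2 ∈ C ∧ (C ∩ {y ∈ W | ρ y < 0}).Nonempty ∧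
        C ⊆ {y ∈ W | affinePerturbation ρ χ z.1 y < 0} := by
  have hR0 := (contDiff_uncurry_affinePerturbation hρ hχ).continuous
  rcases lt_trichotomy (ρ y₀) 0 with h | h | h
  · have h1 : ∀ᶠ z : ((V →L[ℝ] ℝ) × ℝ) × V in 𝓝 (0, y₀), ρ z.2 < 0 :=
      (hρ.continuous.comp continuous_snd).continuousAt.eventually (gt_mem_nhds h)
    have h2 : ∀ᶠ z : ((V →L[ℝ] ℝ) × ℝ) × V in 𝓝 (0, y₀), z.2 ∈ W :=
      continuous_snd.continuousAt.eventually (hW.mem_nhds hy₀)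
    filter_upwards [h1, h2] with z hz hzW hneg
    exact ⟨{z.2}, isPreconnected_singleton, rfl, ⟨z.2, rfl, hzW, hz⟩,
      singleton_subset_iff.2 ⟨hzW, hneg⟩⟩
  · obtain ⟨w, hw⟩ : ∃ w, fderiv ℝ ρ y₀ w < 0 := by
      obtain ⟨v, hv⟩ : ∃ v, fderiv ℝ ρ y₀ v ≠ 0 := by
        by_contra! hall
        exact hd (ContinuousLinearMap.ext hall)
      rcases lt_or_gt_of_ne hv with hv | hv
      · exact ⟨v, hv⟩
      · exact ⟨-v, by simpa using hv⟩
    have hfd := continuous_fderiv_affinePerturbation hρ hχ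
    have hH : IsOpen {z : ((V →L[ℝ] ℝ) × ℝ) × V |
        fderiv ℝ (affinePerturbation ρ χ z.1) z.2 w < 0 ∧ z.2 ∈ W} := by
      have hfw : Continuous fun z : ((V →L[ℝ] ℝ) × ℝ) × V =>
          fderiv ℝ (affinePerturbation ρ χ z.1) z.2 w := by fun_prop
      exact (isOpen_lt hfw continuous_const).inter (hW.preimage continuous_snd)
    have hcont : Continuous fun a : (((V →L[ℝ] ℝ) × ℝ) × V) × ℝ => (a.1.1, a.1.2 + a.2 • w) := by
      fun_prop
    have hev := (hcont.tendsto ((0, y₀), 0)).eventually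
      (hH.mem_nhds (by simpa using ⟨hw, hy₀⟩))
    rw [nhds_prod_eq, eventually_prod_iff] at hev
    obtain ⟨pz, hpz, pt, hpt, hH'⟩ := hev
    obtain ⟨ε, hε, hball⟩ := Metric.eventually_nhds_iff_ball.1 hpt
    have h1 := eventually_pos_of_fderiv_pos (g := fun y => -ρ y) (x := y₀) (v := w)
      (hρ.differentiable (by simp) y₀).neg (by simp [h])
      (by rw [fderiv_fun_neg]; simpa using hw)
    have h2 := (tendsto_add_smul y₀ w).eventually (hW.mem_nhds hy₀)
    -- The length `t` is fixed before `z`: for all nearby `z`, the segment from `z.2` along `w`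
    -- stays in the perturbed region, where the function decreases, and ends in `{ρ < 0}`.
    obtain ⟨t, ht, htW, ht0, htε⟩ := (h1.and (h2.and (Ioo_mem_nhdsGT hε))).exists
    have hopen : IsOpen {y ∈ W | ρ y < 0} :=
      hW.inter (isOpen_lt hρ.continuous continuous_const)
    have hshift : Continuous fun z : ((V →L[ℝ] ℝ) × ℝ) × V => z.2 + t • w := by fun_prop
    have h3 := (hshift.tendsto (0, y₀)).eventually
      (hopen.mem_nhds ⟨htW, by simpa using ht⟩)
    filter_upwards [hpz, h3] with z hz hzt hneg
    have hline : ∀ s ∈ Icc (0 : ℝ) t,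
        fderiv ℝ (affinePerturbation ρ χ z.1) (z.2 + s • w) w < 0 ∧ z.2 + s • w ∈ W := by
      intro s hs
      refine hH' hz (hball s ?_)
      rw [Real.ball_eq_Ioo]
      exact ⟨by linarith [hs.1], by linarith [hs.2]⟩
    have hder : ∀ s : ℝ, HasDerivAt (fun s : ℝ => affinePerturbation ρ χ z.1 (z.2 + s • w))
        (fderiv ℝ (affinePerturbation ρ χ z.1) (z.2 + s • w) w) s := by
      intro s
      have h4 : HasDerivAt (fun s : ℝ => z.2 + s • w) w s := by
        simpa using ((hasDerivAt_id s).smul_const w).const_add z.2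
      exact ((contDiff_affinePerturbation hρ hχ z.1).differentiable
        (by simp) _).hasFDerivAt.comp_hasDerivAt s h4
    have hanti : AntitoneOn (fun s : ℝ => affinePerturbation ρ χ z.1 (z.2 + s • w)) (Icc 0 t) := by
      refine antitoneOn_of_deriv_nonpos (convex_Icc 0 t)
        (fun s _ => (hder s).continuousAt.continuousWithinAt)
        (fun s _ => (hder s).differentiableAt.differentiableWithinAt) fun s hs => ?_
      rw [(hder s).deriv]
      exact (hline s (interior_subset hs)).1.le
    refine ⟨(fun s : ℝ => z.2 + s • w) '' Icc 0 t,
      isPreconnected_Icc.image _ (by fun_prop), ⟨0, ⟨le_rfl, ht0.le⟩, by simp⟩,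
      ⟨_, ⟨t, ⟨ht0.le, le_rfl⟩, rfl⟩, hzt⟩, ?_⟩
    rintro _ ⟨s, hs, rfl⟩
    have h5 := hanti ⟨le_rfl, ht0.le⟩ hs hs.1
    simp only [zero_smul, add_zero] at h5
    exact ⟨(hline s hs).2, h5.trans_lt hneg⟩
  · have h1 := (hR0.tendsto (0, y₀)).eventually
      (lt_mem_nhds (by simpa using h) : ∀ᶠ r in 𝓝 _, (0 : ℝ) < r)
    filter_upwards [h1] with z hz hneg
    exact absurd hneg hz.not_gt

end Perturbation

/-! ### Cutoffs and the transversality hypothesis. -/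

/-- A compact subset of an open subset of `ℝ^d` has a smooth compactly supported cutoff. -/
theorem exists_contDiff_cutoff {d : ℕ} {B O : Set (E d)} (hB : IsCompact B) (hO : IsOpen O)
    (hBO : B ⊆ O) : ∃ χ : E d → ℝ, ContDiff ℝ ∞ χ ∧ HasCompactSupport χ ∧ tsupport χ ⊆ O ∧
      (∀ y, 0 ≤ χ y) ∧ B ⊆ interior {y | χ y = 1} := by
  obtain ⟨K, hK, hBK, hKO⟩ := exists_compact_between hB hO hBO
  obtain ⟨χ, h1, h0, hχ⟩ := exists_contMDiffMap_one_nhds_of_subset_interior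
    (modelWithCornersSelf ℝ (E d)) (n := ⊤) hB.isClosed hBK
  have hsupp : tsupport χ ⊆ K := closure_minimal
    (fun y hy => by_contra fun hyK => hy (h0 y hyK)) hK.isClosed
  exact ⟨χ, χ.contMDiff.contDiff, hK.of_isClosed_subset (isClosed_tsupport _) hsupp,
    hsupp.trans hKO, fun y => (hχ y).1,
    subset_interior_iff_mem_nhdsSet.2 h1⟩

/-- If `∇f(x)` spans a complement of a tangent space which is contained in a hyperplane, then
`d_x f ≠ 0`. -/
theorem fderiv_ne_zero_of_isCompl {d : ℕ} {f : E d → ℝ} {x : E d} {T : Submodule ℝ (E d)}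
    (h : IsCompl (Submodule.span ℝ {gradient f x}) T) {ℓ : E d →L[ℝ] ℝ} (hℓ : ℓ ≠ 0)
    (hT : ∀ v ∈ T, ℓ v = 0) : fderiv ℝ f x ≠ 0 := by
  intro h0
  have hg : gradient f x = 0 := by simp [gradient, h0]
  have htop : T = ⊤ := by
    have := h.sup_eq_top
    rwa [hg, Submodule.span_zero_singleton, bot_sup_eq] at this
  exact hℓ (ContinuousLinearMap.ext fun v => hT v (htop ▸ Submodule.mem_top))

end MorseDomain

/-! ### Construction of the perturbed domain. -/

open MorseDomain
open Set Filter Topology in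
theorem proposition8 (d : ℕ) (f : E d → ℝ) (hf : ContDiff ℝ ∞ f)
    (D : Set (E d)) (hD : IsSmoothBoundedDomain D)
    -- `∇f(x) ⊕ T_x ∂D = ℝ^d` at every boundary point
    (htrans : ∀ x ∈ frontier D,
      IsCompl (Submodule.span ℝ {gradient f x}) (tangentSpace (frontier D) x))
    (S₁ : Set (E d)) (hS₁ : IsRelOpen (frontier D) S₁)
    (hMorse : IsMorseOn f (frontier D) (closure S₁))
    -- the boundary of the relatively open set `S₁` in `∂D` is `closure S₁ \ S₁`
    (hbdry : ∀ x ∈ closure S₁ \ S₁, ¬ IsCriticalPoint f (frontier D) x)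
    (S₁' : Set (E d)) (hS₁' : IsRelOpen (frontier D) S₁') (hsub : closure S₁' ⊆ S₁)
    (hcrit : ∀ x ∈ closure (S₁ \ S₁'), ¬ IsCriticalPoint f (frontier D) x)
    (Vm Vp : Set (E d)) (hVm : IsOpen Vm) (hVp : IsOpen Vp)
    (hVmD : closure Vm ⊆ D ∪ S₁') (hDVp : closure D \ S₁' ⊆ Vp) :
    ∃ D' : Set (E d), IsSmoothBoundedDomain D' ∧ S₁' ⊆ frontier D' ∧
      closure Vm ⊆ D' ∪ S₁' ∧ closure D' \ S₁' ⊆ Vp ∧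
      IsMorseOn f (frontier D') (frontier D') := by
  have hDo := hD.isOpen
  have hFc : IsCompact (frontier D) :=
    Metric.isCompact_of_isClosed_isBounded isClosed_frontier
      (hD.isBounded.closure.subset frontier_subset_closure)
  obtain ⟨W₀, ρ, hW₀, hFW₀, hρ, hρW₀⟩ :=
    exists_contDiff_isDefiningFunctionOn hDo hFc hD.smooth_frontier
  -- shrink the neighbourhood of the boundary so that `f` has no critical point there
  obtain ⟨W, hW, hFW, hρW, hfW⟩ : ∃ W : Set (E d), IsOpen W ∧ frontier D ⊆ W ∧
      IsDefiningFunctionOn D W ρ ∧ ∀ y ∈ W, fderiv ℝ f y ≠ 0 := by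
    refine ⟨W₀ ∩ {y | fderiv ℝ f y ≠ 0},
      hW₀.inter (isOpen_ne_fun (hf.continuous_fderiv (by simp)) continuous_const),
      fun x hx => ⟨hFW₀ hx, fderiv_ne_zero_of_isCompl (htrans x hx)
        (hρW₀.fderiv_ne_zero x (hFW₀ hx)) fun v hv =>
          hρW₀.fderiv_eq_zero_of_mem_tangentSpace hDo hW₀ (hFW₀ hx) hv⟩,
      ⟨hρ.contDiffOn, fun y hy => hρW₀.fderiv_ne_zero y hy.1, ?_⟩, fun y hy => hy.2⟩
    ext y
    constructor
    · rintro ⟨hyD, hy⟩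
      exact ⟨hy, (hρW₀.neg_iff hy.1).2 hyD⟩
    · rintro ⟨hy, hneg⟩
      exact ⟨(hρW₀.neg_iff hy.1).1 hneg, hy⟩
  have hFρ : ∀ y ∈ W, (y ∈ frontier D ↔ ρ y = 0) := fun y hy => hρW.mem_frontier_iff hDo hW hy
  obtain ⟨U₁, hU₁, hS₁U⟩ := hS₁
  obtain ⟨U₁', -, hS₁'U⟩ := hS₁'
  obtain ⟨χ, hχ, hK, hKO, hχ0, hχ1⟩ := exists_contDiff_cutoff (B := frontier D \ S₁)
    (O := W ∩ (Vp ∩ (closure S₁')ᶜ))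
    (by
      have : frontier D \ S₁ = frontier D \ U₁ := by rw [hS₁U, sdiff_self_inter]
      rw [this]
      exact hFc.diff hU₁)
    (hW.inter (hVp.inter isClosed_closure.isOpen_compl))
    (fun x hx => ⟨hFW hx.1, hDVp ⟨frontier_subset_closure hx.1,
      fun h => hx.2 (hsub (subset_closure h))⟩, fun h => hx.2 (hsub h)⟩)
  have hKW : tsupport χ ⊆ W := fun x hx => (hKO hx).1
  set R := affinePerturbation ρ χ with hR
  have hRs : ∀ p, ContDiff ℝ ∞ (R p) := contDiff_affinePerturbation hρ hχ
  -- the conditions on the perturbation which hold near `0`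
  have hev1 : ∀ᶠ p in 𝓝 (0 : (E d →L[ℝ] ℝ) × ℝ), ∀ y ∈ tsupport χ, fderiv ℝ (R p) y ≠ 0 := by
    refine IsCompact.eventually_forall_of_forall_eventually hK fun y hy => ?_
    exact (continuous_fderiv_affinePerturbation hρ hχ).continuousAt.eventually_ne
      (by simpa using hρW.fderiv_ne_zero y (hKW hy))
  have hev2 : ∀ᶠ p in 𝓝 (0 : (E d →L[ℝ] ℝ) × ℝ), ∀ y ∈ tsupport χ \ interior {y | χ y = 1},
      R p y = 0 → ∀ μ : ℝ, fderiv ℝ (R p) y ≠ μ • fderiv ℝ f y := by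
    refine IsCompact.eventually_forall_of_forall_eventually
      (IsCompact.diff hK isOpen_interior) fun y hy => ?_
    -- Boundary points here lie in `S₁ \ S₁'`, where criticality is excluded; off the boundary, `R p
    -- y ≠ 0` persists.
    by_cases h0 : ρ y = 0
    · have hyF := (hFρ y (hKW hy.1)).2 h0
      have hyS : y ∈ S₁ := by_contra fun h => hy.2 (hχ1 ⟨hyF, h⟩)
      have hnc := hcrit y (subset_closure ⟨hyS, fun h => (hKO hy.1).2.2 (subset_closure h)⟩)
      refine (eventually_fderiv_affinePerturbation_ne_smul hf hρ hχ (hfW y (hKW hy.1))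
        fun μ hμ => hnc ⟨hyF, fun v hv => ?_⟩).mono fun z hz _ => hz
      have hv0 := hρW.fderiv_eq_zero_of_mem_tangentSpace hDo hW (hKW hy.1) hv
      have hμ0 : μ ≠ 0 := fun h => hρW.fderiv_ne_zero y (hKW hy.1) (by rw [hμ, h, zero_smul])
      rw [hμ, smul_apply, smul_eq_mul] at hv0
      exact (mul_eq_zero.1 hv0).resolve_left hμ0
    · have h1 := (contDiff_uncurry_affinePerturbation hρ hχ).continuous.continuousAt.eventually_ne
        (x := ((0, y) : ((E d →L[ℝ] ℝ) × ℝ) × E d)) (y := 0) (by simpa using h0)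
      exact h1.mono fun z hz h => absurd h hz
  have hev3 : ∀ᶠ p in 𝓝 (0 : (E d →L[ℝ] ℝ) × ℝ), ∀ y ∈ tsupport χ, R p y < 0 →
      ∃ C : Set (E d), IsPreconnected C ∧ y ∈ C ∧ (C ∩ {y ∈ W | ρ y < 0}).Nonempty ∧
        C ⊆ {y ∈ W | R p y < 0} :=
    IsCompact.eventually_forall_of_forall_eventually hK fun y hy =>
      eventually_exists_isPreconnected hρ hχ hW (hKW hy) (hρW.fderiv_ne_zero y (hKW hy))
  -- choice of the perturbation
  obtain ⟨p, hp, hp1, hp2, hp3, hp4⟩ : ∃ p : (E d →L[ℝ] ℝ) × ℝ,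
      (∀ (x : E d) (μ : ℝ), fderiv ℝ ρ x + p.1 = μ • fderiv ℝ f x →
        ρ x + (p.1 x + p.2) = 0 → ∀ (v : E d) (ν : ℝ), fderiv ℝ ρ x v + p.1 v = 0 →
        ν • fderiv ℝ f x + μ • fderiv ℝ (fderiv ℝ f) x v - fderiv ℝ (fderiv ℝ ρ) x v = 0 →
        v = 0) ∧
      (∀ y ∈ tsupport χ, fderiv ℝ (R p) y ≠ 0) ∧
      (∀ y ∈ tsupport χ \ interior {y | χ y = 1},
        R p y = 0 → ∀ μ : ℝ, fderiv ℝ (R p) y ≠ μ • fderiv ℝ f y) ∧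
      (∀ y ∈ tsupport χ, R p y < 0 →
        ∃ C : Set (E d), IsPreconnected C ∧ y ∈ C ∧ (C ∩ {y ∈ W | ρ y < 0}).Nonempty ∧
          C ⊆ {y ∈ W | R p y < 0}) ∧
      ∀ y ∈ tsupport χ, p.1 y + p.2 < 0 := by
    -- The constant `-ε` is negative and keeps the smallness conditions on a neighbourhood of `(0,
    -- -ε)`; density supplies a generic `p` there.
    have hlim : Tendsto (fun ε : ℝ => ((0, -ε) : (E d →L[ℝ] ℝ) × ℝ)) (𝓝[>] 0) (𝓝 0) := by
      have hc : Continuous fun ε : ℝ => ((0, -ε) : (E d →L[ℝ] ℝ) × ℝ) := by fun_prop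
      have := hc.tendsto 0
      simp only [neg_zero, Prod.mk_zero_zero] at this
      exact this.mono_left nhdsWithin_le_nhds
    obtain ⟨ε, hε, hε0⟩ := ((hlim.eventually
      (hev1.and (hev2.and hev3)).eventually_nhds).and self_mem_nhdsWithin).exists
    have hε0 : 0 < ε := hε0
    have hneg : ∀ᶠ p in 𝓝 ((0, -ε) : (E d →L[ℝ] ℝ) × ℝ), ∀ y ∈ tsupport χ, p.1 y + p.2 < 0 := by
      refine IsCompact.eventually_forall_of_forall_eventually hK fun y hy => ?_
      have hc : Continuous fun z : ((E d →L[ℝ] ℝ) × ℝ) × E d => z.1.1 z.2 + z.1.2 := by fun_prop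
      exact hc.continuousAt.eventually (gt_mem_nhds (by simpa using hε0))
    obtain ⟨p, hp, ⟨hp1, hp2, hp3⟩, hp4⟩ := ((mem_closure_iff_frequently.1
      (dense_nondegenerate_affine hf hρ ((0, -ε) : (E d →L[ℝ] ℝ) × ℝ))).and_eventually
        (hε.and hneg)).exists
    exact ⟨p, hp, hp1, hp2, hp3, hp4⟩
  have hRK : ∀ {y}, y ∉ tsupport χ → R p =ᶠ[𝓝 y] ρ := fun hy =>
    affinePerturbation_eventuallyEq_of_notMem hy p
  have hRle : ∀ y, R p y ≤ ρ y := by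
    intro y
    by_cases hy : y ∈ tsupport χ
    · have := mul_nonpos_of_nonneg_of_nonpos (hχ0 y) (hp4 y hy).le
      simp only [hR, affinePerturbation]
      linarith
    · exact (hRK hy).self_of_nhds.le
  set D' : Set (E d) := D ∪ {y ∈ W | R p y < 0} with hD'
  have hD'o : IsOpen D' :=
    hDo.union (hW.inter (isOpen_lt (hRs p).continuous continuous_const))
  have hD'W : IsDefiningFunctionOn D' W (R p) := by
    refine ⟨(hRs p).contDiffOn, fun y hy => ?_, ?_⟩
    · by_cases hyK : y ∈ tsupport χ
      · exact hp1 y hyK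
      · rw [(hRK hyK).fderiv_eq]
        exact hρW.fderiv_ne_zero y hy
    · ext y
      constructor
      · rintro ⟨hyD | hyD, hy⟩
        · exact ⟨hy, (hRle y).trans_lt ((hρW.neg_iff hy).2 hyD)⟩
        · exact hyD
      · exact fun hy => ⟨Or.inr hy, hy.1⟩
  have hD'K : D' ⊆ D ∪ tsupport χ := by
    rintro y (hy | ⟨hyW, hy⟩)
    · exact Or.inl hy
    · by_cases hyK : y ∈ tsupport χ
      · exact Or.inr hyK
      · rw [(hRK hyK).self_of_nhds] at hy
        exact Or.inl ((hρW.neg_iff hyW).1 hy)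
  have hcl : closure D' ⊆ closure D ∪ tsupport χ := by
    refine (closure_mono hD'K).trans ?_
    rw [closure_union, (isClosed_tsupport χ).closure_eq]
  have hF'W : frontier D' ⊆ W := by
    intro x hx
    rw [hD'o.frontier_eq] at hx
    rcases hcl hx.1 with h | h
    · exact hFW (hDo.frontier_eq ▸ ⟨h, fun h' => hx.2 (Or.inl h')⟩)
    · exact hKW h
  have hF'R : ∀ y ∈ W, (y ∈ frontier D' ↔ R p y = 0) := fun y hy =>
    hD'W.mem_frontier_iff hD'o hW hy
  have hFF' : frontier D ∩ (tsupport χ)ᶜ = frontier D' ∩ (tsupport χ)ᶜ := by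
    ext y
    refine and_congr_left fun hyK => ?_
    have hRy := (hRK hyK).self_of_nhds
    constructor
    · exact fun hy => (hF'R y (hFW hy)).2 (hRy.trans ((hFρ y (hFW hy)).1 hy))
    · exact fun hy => (hFρ y (hF'W hy)).2 (hRy.symm.trans ((hF'R y (hF'W hy)).1 hy))
  refine ⟨D', ⟨hD'o, ?_, ⟨hD.isConnected.nonempty.mono subset_union_left, ?_⟩,
    fun x hx => ⟨W, R p, hW, hF'W hx, hD'W⟩⟩, ?_, ?_, ?_, ?_⟩
  · exact (hD.isBounded.union (IsCompact.isBounded hK)).subset hD'K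
  · obtain ⟨x₀, hx₀⟩ := hD.isConnected.nonempty
    refine isPreconnected_of_forall x₀ fun y hy => ?_
    by_cases hyD : y ∈ D
    · exact ⟨D, subset_union_left, hx₀, hyD, hD.isConnected.isPreconnected⟩
    · have hyR : R p y < 0 := (hy.resolve_left hyD).2
      obtain ⟨C, hC, hyC, ⟨z, hzC, hzW, hz⟩, hCD⟩ := hp3 y ((hD'K hy).resolve_left hyD) hyR
      exact ⟨D ∪ C, union_subset_union_right D hCD, Or.inl hx₀, Or.inr hyC,
        -- The set `C` meets `{ρ < 0} ∩ W`, which is contained in `D`.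
        hD.isConnected.isPreconnected.union' ⟨z, (hρW.neg_iff hzW).1 hz, hzC⟩ hC⟩
  · intro x hx
    have hxF : x ∈ frontier D := (hS₁'U ▸ hx : x ∈ frontier D ∩ U₁').1
    have hxK : x ∉ tsupport χ := fun h => (hKO h).2.2 (subset_closure hx)
    exact (hFF' ▸ ⟨hxF, hxK⟩ : x ∈ frontier D' ∩ (tsupport χ)ᶜ).1
  · exact hVmD.trans (union_subset_union_left _ subset_union_left)
  · rintro x ⟨hx, hxS⟩
    rcases hcl hx with h | h
    · exact hDVp ⟨h, hxS⟩
    · exact (hKO h).2.1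
  · rintro x hxF' ⟨-, hxc⟩
    have hxW := hF'W hxF'
    have hS' : frontier D' ∩ W = {y ∈ W | R p y = 0} := by
      ext y
      exact and_comm.trans (and_congr_right fun hy => hF'R y hy)
    -- Criticality gives a multiplier, since the kernel of the differential of `R p` consists of
    -- tangent vectors; `df ≠ 0` on `W` makes it invertible.
    obtain ⟨c, hc⟩ : ∃ c : ℝ, fderiv ℝ f x = c • fderiv ℝ (R p) x := by
      refine exists_eq_smul_of_ker_le fun v hv => ?_
      obtain ⟨_, φ, hφ, -, -, hker⟩ := exists_isLocalParam hW (hRs p).contDiffOn hS' hxF' hxW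
        (hD'W.fderiv_ne_zero x hxW)
      obtain ⟨u, rfl⟩ := hker v hv
      exact hxc _ (hφ.fderiv_mem_tangentSpace u)
    have hc0 : c ≠ 0 := fun h => hfW x hxW (by rw [hc, h, zero_smul])
    have hμ : fderiv ℝ (R p) x = c⁻¹ • fderiv ℝ f x := by rw [hc, inv_smul_smul₀ hc0]
    by_cases hxK : x ∈ tsupport χ
    · by_cases hx1 : x ∈ interior {y | χ y = 1}
      · have hRx : ∀ᶠ y in 𝓝 x, R p y = ρ y + (p.1 y + p.2) := by
          filter_upwards [mem_interior_iff_mem_nhds.1 hx1] with y hy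
          have hy : χ y = 1 := hy
          simp [hR, affinePerturbation, hy]
        have hd1 : ∀ᶠ y in 𝓝 x, fderiv ℝ (R p) y = fderiv ℝ ρ y + p.1 := by
          filter_upwards [hRx.eventually_nhds] with y hy
          rw [Filter.EventuallyEq.fderiv_eq hy]
          exact ((hρ.differentiable (by simp) y).hasFDerivAt.add
            (p.1.hasFDerivAt.add_const p.2)).fderiv
        have hd2 : fderiv ℝ (fderiv ℝ (R p)) x = fderiv ℝ (fderiv ℝ ρ) x := by
          rw [Filter.EventuallyEq.fderiv_eq hd1, fderiv_add_const]
        refine hasNondegenerateHessian_of_lagrange hf hW (hRs p).contDiffOn hS' hxF' hxW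
          (hD'W.fderiv_ne_zero x hxW) hμ fun v ν hv hvν => ?_
        refine hp x c⁻¹ ?_ ?_ v ν ?_ ?_
        · rw [← hd1.self_of_nhds, hμ]
        · rw [← hRx.self_of_nhds]
          exact (hF'R x hxW).1 hxF'
        · rwa [hd1.self_of_nhds, add_apply] at hv
        · rwa [hd2] at hvν
      · exact absurd hμ (hp2 x ⟨hxK, hx1⟩ ((hF'R x hxW).1 hxF') _)
    · have hxF : x ∈ frontier D := (hFF' ▸ ⟨hxF', hxK⟩ : x ∈ frontier D ∩ (tsupport χ)ᶜ).1
      -- A boundary point outside `S₁` would have `χ x = 1`.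
      have hxS : x ∈ S₁ := by
        by_contra h
        have h1 : χ x = 1 := (interior_subset (hχ1 ⟨hxF, h⟩) : x ∈ {y | χ y = 1})
        exact hxK (subset_tsupport χ (by simp [h1]))
      refine (hMorse x (subset_closure hxS) ⟨hxF, fun v hv => ?_⟩).of_inter_eq
        (isClosed_tsupport χ).isOpen_compl hxK hFF'
      have := hρW.fderiv_eq_zero_of_mem_tangentSpace hDo hW hxW hv
      rw [hc, (hRK hxK).fderiv_eq, smul_apply, this, smul_zero]
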